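/- Let $\mathbb D=\{z\in\mathbb C:|z|<1\}$, and for $\lambda>0$ and a holomorphic map $f:\mathbb D\to\mathbb D$ let $$\Omega_\lambda(f):=\Big\{z\in\mathbb D:\ \frac{1-|f(z)|^2}{1-|z|^2}<\lambda\Big\}.$$ Let $\lambda>0$ and let $f:\mathbb D\to\mathbb D$ be holomorphic. Then $\Omega_\lambda(f)=\mathbb D$ if and only if the following two conditions hold: (a) $f$ is a finite Blaschke product, i.e. there are $\theta\in\mathbb R$, an integer $n\ge 1$ and points $a_1,\dots,a_n\in\mathbb D$ such that $$f(z)=e^{i\theta}\prod_{k=1}^{n}\frac{z-a_k}{1-\overline{a_k}\,z}\qquad\text{for all } z\in\mathbb D;$$ (b) $\lambda\ge\sup_{z\in\mathbb D}|f'(z)|$ and $\lambda>1$. -/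

import Mathlib

open Metric ComplexConjugate

/-- The lower level set `Ω_lam(f) = {z ∈ 𝔻 : (1 - |f z|²) / (1 - |z|²) < lam}` of a map `f` on the
open unit disk `𝔻 = ball 0 1`. -/
def levelSetOmega (lam : ℝ) (f : ℂ → ℂ) : Set ℂ :=
  {z | z ∈ ball (0 : ℂ) 1 ∧ (1 - ‖f z‖ ^ 2) / (1 - ‖z‖ ^ 2) < lam}

/-- `f` coincides on the open unit disk with a finite Blaschke product of degree `n ≥ 1`, with
zeros `a k ∈ 𝔻` (listed with multiplicity) and a unimodular factor `e^{iθ}`. -/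
def IsFiniteBlaschkeProduct (f : ℂ → ℂ) : Prop :=
  ∃ (θ : ℝ) (n : ℕ) (a : Fin n → ℂ), 1 ≤ n ∧ (∀ k, a k ∈ ball (0 : ℂ) 1) ∧
    ∀ z ∈ ball (0 : ℂ) 1,
      f z = Complex.exp (θ * Complex.I) * ∏ k, (z - a k) / (1 - conj (a k) * z)

open Filter Topology

/-! If the quotient is bounded by `lam`, then |f| → 1 at the circle. This forces f to be a finite
Blaschke product (`exists_eq_blaschkeProd`): zeros are divided out until a zero-free, hence
constant, factor remains. For a Blaschke product B, telescoping 1 - |B|² over its partial products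
gives (1 - |z|²)‖G‖² with G a holomorphic vector (`one_sub_norm_blaschkeProd_sq`), so the quotient
is ‖G‖². On the circle ‖G‖² = |B'| (`norm_deriv_blaschkeProd`). The maximum principle, applied to
both G and B', shows that the two have the same upper bounds on the disk
(`norm_blaschkeVec_sq_le_iff`). If `lam > 1`, the strong maximum principle makes the bound strict
(`norm_blaschkeVec_sq_lt`); conversely a zero of f forces `lam > 1`. -/

/-- The Blaschke factor with zero `a`. -/
noncomputable def blaschkeFactor (a z : ℂ) : ℂ := (z - a) / (1 - conj a * z)

/-- The Blaschke product with zeros `a 0, …, a (n - 1)`. -/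
noncomputable def blaschkeProd (a : ℕ → ℂ) (n : ℕ) (z : ℂ) : ℂ :=
  ∏ k ∈ Finset.range n, blaschkeFactor (a k) z

/-- The filter of points of the open unit disk tending to the unit circle. -/
noncomputable def nearCircle : Filter ℂ := comap norm (𝓝[<] 1)

/-! ### Blaschke factors and products. -/

lemma one_sub_conj_mul_ne_zero {a z : ℂ} (ha : ‖a‖ < 1) (hz : ‖z‖ ≤ 1) : 1 - conj a * z ≠ 0 := by
  intro h
  have h1 : ‖conj a * z‖ = 1 := by rw [← sub_eq_zero.mp h, norm_one]
  rw [norm_mul, Complex.norm_conj] at h1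
  nlinarith [norm_nonneg a, norm_nonneg z]

lemma norm_sub_sq_add (a z : ℂ) :
    ‖1 - conj a * z‖ ^ 2 - ‖z - a‖ ^ 2 = (1 - ‖a‖ ^ 2) * (1 - ‖z‖ ^ 2) := by
  simp only [← Complex.normSq_eq_norm_sq, Complex.normSq_apply, Complex.sub_re, Complex.sub_im,
    Complex.mul_re, Complex.mul_im, Complex.conj_re, Complex.conj_im, Complex.one_re,
    Complex.one_im]
  ring

lemma one_sub_norm_blaschkeFactor_sq {a z : ℂ} (ha : ‖a‖ < 1) (hz : ‖z‖ ≤ 1) :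
    1 - ‖blaschkeFactor a z‖ ^ 2 =
      (1 - ‖z‖ ^ 2) * ((1 - ‖a‖ ^ 2) / ‖1 - conj a * z‖ ^ 2) := by
  have h := norm_pos_iff.mpr (one_sub_conj_mul_ne_zero ha hz)
  rw [blaschkeFactor, norm_div, div_pow]
  rw [← mul_div_assoc, mul_comm (1 - ‖z‖ ^ 2), ← norm_sub_sq_add, sub_div, div_self (by positivity)]

lemma norm_blaschkeFactor_lt_one {a z : ℂ} (ha : ‖a‖ < 1) (hz : ‖z‖ < 1) :
    ‖blaschkeFactor a z‖ < 1 := by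
  have h := norm_pos_iff.mpr (one_sub_conj_mul_ne_zero ha hz.le)
  have h1 := one_sub_norm_blaschkeFactor_sq ha hz.le
  have h2 : 0 < (1 - ‖z‖ ^ 2) * ((1 - ‖a‖ ^ 2) / ‖1 - conj a * z‖ ^ 2) := by
    have : 0 < 1 - ‖z‖ ^ 2 := by nlinarith [norm_nonneg z]
    have : 0 < 1 - ‖a‖ ^ 2 := by nlinarith [norm_nonneg a]
    positivity
  nlinarith [norm_nonneg (blaschkeFactor a z)]

lemma norm_blaschkeFactor_eq_one {a z : ℂ} (ha : ‖a‖ < 1) (hz : ‖z‖ = 1) :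
    ‖blaschkeFactor a z‖ = 1 := by
  have h1 := one_sub_norm_blaschkeFactor_sq ha hz.le
  rw [hz] at h1
  have : ‖blaschkeFactor a z‖ ^ 2 = 1 := by linarith
  exact (pow_eq_one_iff_of_nonneg (norm_nonneg _) two_ne_zero).mp this

lemma hasDerivAt_blaschkeFactor {a z : ℂ} (h : 1 - conj a * z ≠ 0) :
    HasDerivAt (blaschkeFactor a) (((1 - ‖a‖ ^ 2 : ℝ) : ℂ) / (1 - conj a * z) ^ 2) z := by
  have h1 : HasDerivAt (fun z : ℂ => z - a) 1 z := (hasDerivAt_id z).sub_const a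
  have h2 : HasDerivAt (fun z : ℂ => 1 - conj a * z) (-(conj a * 1)) z :=
    ((hasDerivAt_id z).const_mul (conj a)).const_sub 1
  refine (h1.div h2 h).congr_deriv ?_
  congr 1
  push_cast
  rw [← Complex.mul_conj']
  ring

lemma differentiableAt_blaschkeProd {a : ℕ → ℂ} {n : ℕ} {z : ℂ}
    (h : ∀ k ∈ Finset.range n, 1 - conj (a k) * z ≠ 0) :
    DifferentiableAt ℂ (blaschkeProd a n) z := by
  unfold blaschkeProd
  exact DifferentiableAt.fun_finsetProd
    fun k hk => (hasDerivAt_blaschkeFactor (h k hk)).differentiableAt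

/-! ### Functions whose modulus tends to 1 at the circle. -/

lemma eventually_nearCircle_iff {p : ℂ → Prop} :
    (∀ᶠ z in nearCircle, p z) ↔ ∃ r, 0 < r ∧ r < 1 ∧ ∀ z, r < ‖z‖ → ‖z‖ < 1 → p z := by
  rw [nearCircle, ((nhdsLT_basis (1 : ℝ)).comap norm).eventually_iff]
  constructor
  · rintro ⟨r, hr, h⟩
    refine ⟨max r (1 / 2), by positivity, by simp [hr]; norm_num, fun z h1 h2 => h ⟨?_, h2⟩⟩
    exact (le_max_left _ _).trans_lt h1
  · rintro ⟨r, -, hr, h⟩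
    exact ⟨r, hr, fun z hz => h z hz.1 hz.2⟩

lemma eventually_norm_lt_nearCircle : ∀ᶠ z in nearCircle, ‖z‖ < 1 :=
  eventually_nearCircle_iff.mpr ⟨1 / 2, by norm_num, by norm_num, fun _ _ h => h⟩

lemma tendsto_norm_nearCircle : Tendsto (fun z : ℂ => ‖z‖) nearCircle (𝓝 1) :=
  tendsto_comap.mono_right nhdsWithin_le_nhds

lemma tendsto_norm_of_one_sub_sq_le {g : ℂ → ℂ} (C : ℝ)
    (hg : ∀ z, ‖z‖ < 1 → ‖g z‖ < 1 ∧ 1 - ‖g z‖ ^ 2 ≤ C * (1 - ‖z‖ ^ 2)) :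
    Tendsto (fun z => ‖g z‖) nearCircle (𝓝 1) := by
  have h1 : Tendsto (fun z : ℂ => 1 - C * (1 - ‖z‖ ^ 2)) nearCircle (𝓝 1) := by
    have := ((tendsto_norm_nearCircle.pow 2).const_sub 1).const_mul C |>.const_sub 1
    simpa using this
  have h2 : Tendsto (fun z => ‖g z‖ ^ 2) nearCircle (𝓝 1) := by
    refine tendsto_of_tendsto_of_tendsto_of_le_of_le' h1 tendsto_const_nhds ?_ ?_
    · filter_upwards [eventually_norm_lt_nearCircle] with z hz
      linarith [(hg z hz).2]
    · filter_upwards [eventually_norm_lt_nearCircle] with z hz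
      nlinarith [(hg z hz).1, norm_nonneg (g z)]
  simpa using h2.sqrt

lemma tendsto_norm_blaschkeFactor {a : ℂ} (ha : ‖a‖ < 1) :
    Tendsto (fun z => ‖blaschkeFactor a z‖) nearCircle (𝓝 1) := by
  refine tendsto_norm_of_one_sub_sq_le ((1 - ‖a‖ ^ 2) / (1 - ‖a‖) ^ 2) fun z hz =>
    ⟨norm_blaschkeFactor_lt_one ha hz, ?_⟩
  rw [one_sub_norm_blaschkeFactor_sq ha hz.le, mul_comm]
  have h3 : 1 - ‖a‖ ≤ ‖1 - conj a * z‖ := by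
    have := norm_sub_norm_le (1 : ℂ) (conj a * z)
    rw [norm_one, norm_mul, Complex.norm_conj] at this
    nlinarith [norm_nonneg a, norm_nonneg z]
  have h4 : 0 < 1 - ‖a‖ := by linarith
  have h5 : 0 ≤ 1 - ‖a‖ ^ 2 := by nlinarith [norm_nonneg a]
  have h6 : 0 ≤ 1 - ‖z‖ ^ 2 := by nlinarith [norm_nonneg z]
  gcongr

/-- As `h` need not extend to the circle, the maximum principle is used on disks of radius `s < 1`.
-/
lemma norm_le_one_of_tendsto_nearCircle {h : ℂ → ℂ} (hd : DifferentiableOn ℂ h (ball 0 1))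
    (ht : Tendsto (fun z => ‖h z‖) nearCircle (𝓝 1)) {z : ℂ} (hz : ‖z‖ < 1) : ‖h z‖ ≤ 1 := by
  refine le_of_forall_gt_imp_ge_of_dense fun c hc => ?_
  obtain ⟨r, hr0, hr1, hr⟩ := eventually_nearCircle_iff.mp (ht.eventually_le_const hc)
  obtain ⟨s, hs, hs1⟩ := exists_between (max_lt hz hr1)
  have hzs := (le_max_left _ _).trans_lt hs
  have hrs := (le_max_right _ _).trans_lt hs
  have hs0 : s ≠ 0 := (hr0.trans hrs).ne'
  refine Complex.norm_le_of_forall_mem_frontier_norm_le (U := ball 0 s) isBounded_ball ?_ ?_ ?_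
  · refine (hd.mono ?_).diffContOnCl
    rw [closure_ball _ hs0]
    exact closedBall_subset_ball hs1
  · intro w hw
    rw [frontier_ball _ hs0, mem_sphere_zero_iff_norm] at hw
    exact hr w (by rw [hw]; exact hrs) (by rw [hw]; exact hs1)
  · rw [closure_ball _ hs0]
    simpa using hzs.le

/-- The maximum principle for both `h` and `1 / h` gives |h| = 1, so `h` is constant. -/
lemma exists_unimodular_of_ne_zero {h : ℂ → ℂ} (hd : DifferentiableOn ℂ h (ball 0 1))
    (ht : Tendsto (fun z => ‖h z‖) nearCircle (𝓝 1)) (h0 : ∀ z, ‖z‖ < 1 → h z ≠ 0) :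
    ∃ θ : ℝ, ∀ z, ‖z‖ < 1 → h z = Complex.exp (θ * Complex.I) := by
  have hle : ∀ z, ‖z‖ < 1 → ‖h z‖ ≤ 1 := fun z hz => norm_le_one_of_tendsto_nearCircle hd ht hz
  have hge : ∀ z, ‖z‖ < 1 → ‖h z‖ = 1 := by
    intro z hz
    have h1 := norm_le_one_of_tendsto_nearCircle (h := fun z => (h z)⁻¹)
      (hd.inv fun z hz => h0 z (by simpa using hz)) (by simpa using ht.inv₀ one_ne_zero) hz
    rw [norm_inv] at h1
    refine le_antisymm (hle z hz) ?_
    exact (inv_le_one₀ (norm_pos_iff.mpr (h0 z hz))).mp h1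
  have hz0 : ‖(0 : ℂ)‖ < 1 := by simp
  refine ⟨(h 0).arg, fun z hz => ?_⟩
  have hc := Complex.eqOn_of_isPreconnected_of_isMaxOn_norm (f := h) (U := ball 0 1) (c := 0)
    (convex_ball _ _).isPreconnected isOpen_ball hd (by simp)
    (fun w hw => by
      have hw' : ‖w‖ < 1 := by simpa using hw
      simp [hge w hw', hge 0 hz0])
  have := hc (show z ∈ ball 0 1 by simpa using hz)
  rw [this]
  have h2 := Complex.norm_mul_exp_arg_mul_I (h 0)
  rw [hge 0 hz0] at h2
  simpa using h2.symm

/-- A zero `a` in the disk may be divided out as a Blaschke factor. -/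
lemma exists_eq_blaschkeFactor_mul {h : ℂ → ℂ} (hd : DifferentiableOn ℂ h (ball 0 1))
    (ht : Tendsto (fun z => ‖h z‖) nearCircle (𝓝 1)) {a : ℂ} (ha : ‖a‖ < 1) (h0 : h a = 0) :
    ∃ g : ℂ → ℂ, DifferentiableOn ℂ g (ball 0 1) ∧
      Tendsto (fun z => ‖g z‖) nearCircle (𝓝 1) ∧
      ∀ z, ‖z‖ < 1 → h z = blaschkeFactor a z * g z := by
  have hfac : ∀ z, ‖z‖ < 1 → h z = blaschkeFactor a z * (dslope h a z * (1 - conj a * z)) := by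
    intro z hz
    have h1 := one_sub_conj_mul_ne_zero ha hz.le
    have h2 := sub_smul_dslope h a z
    rw [h0, sub_zero, smul_eq_mul] at h2
    rw [← h2, blaschkeFactor, mul_comm (dslope h a z), ← mul_assoc, div_mul_cancel₀ _ h1]
  refine ⟨fun z => dslope h a z * (1 - conj a * z), ?_, ?_, hfac⟩
  · refine DifferentiableOn.mul ?_ (by fun_prop)
    exact (Complex.differentiableOn_dslope (isOpen_ball.mem_nhds (by simpa using ha))).mpr hd
  · have hb := tendsto_norm_blaschkeFactor ha
    have := ht.div hb one_ne_zero
    rw [div_one] at this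
    refine this.congr' ?_
    filter_upwards [eventually_norm_lt_nearCircle, hb.eventually_ne one_ne_zero] with z hz hz0
    rw [Pi.div_apply, hfac z hz, norm_mul, mul_div_cancel_left₀ _ hz0]

/-- A holomorphic function on the disk whose modulus tends to `1` at the circle is a finite
Blaschke product. -/
theorem exists_eq_blaschkeProd {f : ℂ → ℂ} (hd : DifferentiableOn ℂ f (ball 0 1))
    (ht : Tendsto (fun z => ‖f z‖) nearCircle (𝓝 1)) :
    ∃ (θ : ℝ) (n : ℕ) (a : ℕ → ℂ), (∀ k, ‖a k‖ < 1) ∧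
      ∀ z, ‖z‖ < 1 → f z = Complex.exp (θ * Complex.I) * blaschkeProd a n z := by
  -- Otherwise division never stops: every quotient `h` still has a zero, and all these zeros lie in
  -- |z| ≤ r.
  by_contra hcon
  obtain ⟨r, hr0, hr1, hr⟩ :=
    eventually_nearCircle_iff.mp (ht.eventually_ne (one_ne_zero : (1 : ℝ) ≠ 0))
  have key : ∀ n : ℕ, ∃ (a : ℕ → ℂ) (h : ℂ → ℂ), (∀ k, ‖a k‖ ≤ r) ∧
      DifferentiableOn ℂ h (ball 0 1) ∧ Tendsto (fun z => ‖h z‖) nearCircle (𝓝 1) ∧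
      ∀ z, ‖z‖ < 1 → f z = blaschkeProd a n z * h z := by
    intro n
    induction n with
    | zero => exact ⟨fun _ => 0, f, by simpa using hr0.le, hd, ht, by simp [blaschkeProd]⟩
    | succ n ih =>
      obtain ⟨a, h, ha, hhd, hht, hf⟩ := ih
      obtain ⟨b, hb, hb0⟩ : ∃ b, ‖b‖ < 1 ∧ h b = 0 := by
        by_contra! hne
        obtain ⟨θ, hθ⟩ := exists_unimodular_of_ne_zero hhd hht hne
        refine hcon ⟨θ, n, a, fun k => (ha k).trans_lt hr1, fun z hz => ?_⟩
        rw [hf z hz, hθ z hz, mul_comm]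
      have hbr : ‖b‖ ≤ r := by
        by_contra! hlt
        exact hr b hlt hb (by rw [hf b hb, hb0, mul_zero, norm_zero])
      obtain ⟨g, hgd, hgt, hg⟩ := exists_eq_blaschkeFactor_mul hhd hht hb hb0
      refine ⟨Function.update a n b, g, fun k => ?_, hgd, hgt, fun z hz => ?_⟩
      · rcases eq_or_ne k n with rfl | hk
        · simpa using hbr
        · simpa [hk] using ha k
      · have : blaschkeProd (Function.update a n b) n z = blaschkeProd a n z :=
          Finset.prod_congr rfl fun k hk => by
            rw [Function.update_of_ne (Finset.mem_range.mp hk).ne]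
        rw [hf z hz, hg z hz, blaschkeProd.eq_1 _ (n + 1), Finset.prod_range_succ, ← blaschkeProd,
          this, Function.update_self, mul_assoc]
  obtain ⟨s, hs, hs1⟩ := exists_between hr1
  have hsn : ‖(s : ℂ)‖ = s := by simp [abs_of_pos (hr0.trans hs)]
  have hs1' : ‖(s : ℂ)‖ < 1 := by rwa [hsn]
  have hfs : 0 < ‖f s‖ := (norm_nonneg _).lt_of_ne' (hr s (by rwa [hsn]) hs1')
  -- By compactness, one bound below 1 serves for all factors at `s`, so n divisions force ‖f s‖ ≤
  -- ‖blaschkeFactor m s‖ ^ n, which is too small for large n.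
  have hcont : ContinuousOn (fun a => ‖blaschkeFactor a s‖) (closedBall 0 r) := by
    refine ContinuousOn.norm (ContinuousOn.div (by fun_prop) (by fun_prop) fun a ha => ?_)
    exact one_sub_conj_mul_ne_zero ((by simpa using ha : ‖a‖ ≤ r).trans_lt hr1) hs1'.le
  obtain ⟨m, hm, hmax⟩ := (isCompact_closedBall (0 : ℂ) r).exists_isMaxOn
    ⟨0, by simpa using hr0.le⟩ hcont
  have hm1 : ‖blaschkeFactor m s‖ < 1 :=
    norm_blaschkeFactor_lt_one ((by simpa using hm : ‖m‖ ≤ r).trans_lt hr1) hs1'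
  obtain ⟨n, hn⟩ := exists_pow_lt_of_lt_one hfs hm1
  obtain ⟨a, h, ha, hhd, hht, hf⟩ := key n
  refine hn.not_ge ?_
  rw [hf s hs1', norm_mul, blaschkeProd, norm_prod]
  have h1 : ∏ k ∈ Finset.range n, ‖blaschkeFactor (a k) s‖ ≤ ‖blaschkeFactor m s‖ ^ n := by
    have := Finset.prod_le_prod (s := Finset.range n) (fun k _ => norm_nonneg _)
      (fun k _ => hmax (show a k ∈ closedBall 0 r by simpa using ha k))
    simpa using this
  calc _ ≤ ‖blaschkeFactor m s‖ ^ n * 1 := by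
        gcongr
        exact norm_le_one_of_tendsto_nearCircle hhd hht hs1'
    _ = _ := mul_one _

/-! ### The vector G and the derivative of B. -/

/-- The vector of functions with `1 - |B|² = (1 - |z|²) ‖G‖²` for the Blaschke product `B`. -/
noncomputable def blaschkeVec (a : ℕ → ℂ) (n : ℕ) (z : ℂ) : EuclideanSpace ℂ (Fin n) :=
  WithLp.toLp 2 fun k : Fin n =>
    blaschkeProd a k z * (((√(1 - ‖a k‖ ^ 2) : ℝ) : ℂ) / (1 - conj (a k) * z))

lemma norm_blaschkeVec_sq {a : ℕ → ℂ} (ha : ∀ k, ‖a k‖ < 1) (n : ℕ) (z : ℂ) :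
    ‖blaschkeVec a n z‖ ^ 2 = ∑ k ∈ Finset.range n,
      ‖blaschkeProd a k z‖ ^ 2 * ((1 - ‖a k‖ ^ 2) / ‖1 - conj (a k) * z‖ ^ 2) := by
  rw [EuclideanSpace.norm_sq_eq, Finset.sum_range]
  refine Finset.sum_congr rfl fun k _ => ?_
  have h : 0 ≤ 1 - ‖a k‖ ^ 2 := by nlinarith [norm_nonneg (a k), ha k]
  simp only [blaschkeVec, norm_mul, norm_div, mul_pow, div_pow, Complex.norm_real,
    Real.norm_eq_abs, sq_abs, Real.sq_sqrt h]

lemma one_sub_norm_blaschkeProd_sq {a : ℕ → ℂ} (ha : ∀ k, ‖a k‖ < 1) (n : ℕ) {z : ℂ}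
    (hz : ‖z‖ ≤ 1) :
    1 - ‖blaschkeProd a n z‖ ^ 2 = (1 - ‖z‖ ^ 2) * ‖blaschkeVec a n z‖ ^ 2 := by
  rw [norm_blaschkeVec_sq ha]
  induction n with
  | zero => simp [blaschkeProd]
  | succ n ih =>
    rw [Finset.sum_range_succ, mul_add, ← ih, mul_left_comm,
      ← one_sub_norm_blaschkeFactor_sq (ha n) hz, blaschkeProd.eq_1 _ (n + 1),
      Finset.prod_range_succ, ← blaschkeProd, norm_mul]
    ring

lemma norm_blaschkeProd_eq_one {a : ℕ → ℂ} (ha : ∀ k, ‖a k‖ < 1) (n : ℕ) {z : ℂ}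
    (hz : ‖z‖ = 1) : ‖blaschkeProd a n z‖ = 1 := by
  rw [blaschkeProd, norm_prod]
  exact Finset.prod_eq_one fun k _ => norm_blaschkeFactor_eq_one (ha k) hz

lemma differentiableAt_blaschkeVec {a : ℕ → ℂ} (ha : ∀ k, ‖a k‖ < 1) (n : ℕ) {z : ℂ}
    (hz : ‖z‖ ≤ 1) : DifferentiableAt ℂ (blaschkeVec a n) z := by
  rw [differentiableAt_euclidean]
  intro k
  refine DifferentiableAt.mul (differentiableAt_blaschkeProd fun j _ =>
    one_sub_conj_mul_ne_zero (ha j) hz) ?_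
  exact DifferentiableAt.div (by fun_prop) (by fun_prop) (one_sub_conj_mul_ne_zero (ha k) hz)

/-- On the unit circle the logarithmic derivative of a Blaschke factor is a nonnegative multiple
of `z⁻¹`. -/
lemma logDeriv_blaschkeFactor {a z : ℂ} (ha : ‖a‖ < 1) (hz : ‖z‖ = 1) :
    logDeriv (blaschkeFactor a) z =
      z⁻¹ * (((1 - ‖a‖ ^ 2) / ‖1 - conj a * z‖ ^ 2 : ℝ) : ℂ) := by
  have h := one_sub_conj_mul_ne_zero ha hz.le
  have hz0 : z ≠ 0 := by
    rintro rfl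
    simp at hz
  have hb : blaschkeFactor a z ≠ 0 := by
    rw [← norm_ne_zero_iff, norm_blaschkeFactor_eq_one ha hz]
    exact one_ne_zero
  have hconj : z * conj (1 - conj a * z) = z - a := by
    have h1 : z * conj z = 1 := by
      rw [Complex.mul_conj', hz]
      simp
    simp only [map_sub, map_one, map_mul, Complex.conj_conj]
    linear_combination -a * h1
  rw [logDeriv_apply, (hasDerivAt_blaschkeFactor h).deriv, Complex.ofReal_div,
    Complex.ofReal_pow ‖1 - conj a * z‖, ← Complex.mul_conj', blaschkeFactor, ← hconj]
  have h' : conj (1 - conj a * z) ≠ 0 := (map_ne_zero _).mpr h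
  generalize conj (1 - conj a * z) = w at *
  field_simp

/-- The logarithmic derivatives of the factors are nonnegative multiples of the same `z⁻¹`, so their
moduli add without cancellation. -/
lemma norm_deriv_blaschkeProd {a : ℕ → ℂ} (ha : ∀ k, ‖a k‖ < 1) (n : ℕ) {z : ℂ}
    (hz : ‖z‖ = 1) : ‖deriv (blaschkeProd a n) z‖ = ‖blaschkeVec a n z‖ ^ 2 := by
  have hne : ∀ k ∈ Finset.range n, blaschkeFactor (a k) z ≠ 0 := fun k _ => by
    rw [← norm_ne_zero_iff, norm_blaschkeFactor_eq_one (ha k) hz]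
    exact one_ne_zero
  have h1 : logDeriv (blaschkeProd a n) z =
      ∑ k ∈ Finset.range n, logDeriv (blaschkeFactor (a k)) z :=
    logDeriv_prod hne fun k _ =>
      (hasDerivAt_blaschkeFactor (one_sub_conj_mul_ne_zero (ha k) hz.le)).differentiableAt
  have h2 : ‖logDeriv (blaschkeProd a n) z‖ = ‖deriv (blaschkeProd a n) z‖ := by
    rw [logDeriv_apply, norm_div, norm_blaschkeProd_eq_one ha n hz, div_one]
  rw [← h2, h1, norm_blaschkeVec_sq ha,
    Finset.sum_congr rfl fun k _ => logDeriv_blaschkeFactor (ha k) hz, ← Finset.mul_sum,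
    ← Complex.ofReal_sum, norm_mul, norm_inv, hz, inv_one, one_mul, Complex.norm_real,
    Real.norm_of_nonneg]
  · refine Finset.sum_congr rfl fun k _ => ?_
    rw [norm_blaschkeProd_eq_one ha k hz, one_pow, one_mul]
  · refine Finset.sum_nonneg fun k _ => div_nonneg ?_ (by positivity)
    nlinarith [norm_nonneg (a k), ha k]

lemma differentiableOn_deriv_blaschkeProd {a : ℕ → ℂ} (ha : ∀ k, ‖a k‖ < 1) (n : ℕ) :
    DifferentiableOn ℂ (deriv (blaschkeProd a n)) (closedBall 0 1) := by
  let U : Set ℂ := ⋂ k ∈ Finset.range n, {z | 1 - conj (a k) * z ≠ 0}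
  have hU : IsOpen U := isOpen_biInter_finset fun k _ =>
    isOpen_ne_fun (by fun_prop) continuous_const
  have hd : DifferentiableOn ℂ (blaschkeProd a n) U := fun z hz =>
    (differentiableAt_blaschkeProd fun k hk =>
      Set.mem_iInter₂.mp hz k hk).differentiableWithinAt
  exact (hd.deriv hU).mono fun z hz => Set.mem_iInter₂.mpr fun k _ =>
    one_sub_conj_mul_ne_zero (ha k) (by simpa using hz)

lemma le_of_continuousOn_closedBall {φ : ℂ → ℝ} (hφ : ContinuousOn φ (closedBall 0 1)) {c : ℝ}
    (h : ∀ z, ‖z‖ < 1 → φ z ≤ c) {z : ℂ} (hz : ‖z‖ ≤ 1) : φ z ≤ c := by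
  have hcl : closure (ball (0 : ℂ) 1) = closedBall 0 1 := closure_ball _ one_ne_zero
  have hz' : z ∈ closure (ball (0 : ℂ) 1) := by simpa [hcl] using hz
  refine ContinuousWithinAt.closure_le (s := ball (0 : ℂ) 1) (f := φ) (g := fun _ => c) hz'
    ((hφ z (hcl ▸ hz')).mono ball_subset_closedBall) continuousWithinAt_const fun w hw => ?_
  exact h w (by simpa using hw)

lemma norm_le_of_norm_le_on_sphere {E : Type*} [NormedAddCommGroup E] [NormedSpace ℂ E]
    {g : ℂ → E} (hg : DifferentiableOn ℂ g (closedBall 0 1)) {c : ℝ}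
    (h : ∀ z, ‖z‖ = 1 → ‖g z‖ ≤ c) {z : ℂ} (hz : ‖z‖ ≤ 1) : ‖g z‖ ≤ c := by
  have hcl : closure (ball (0 : ℂ) 1) = closedBall 0 1 := closure_ball _ one_ne_zero
  refine Complex.norm_le_of_forall_mem_frontier_norm_le (U := ball 0 1) isBounded_ball
    (DifferentiableOn.diffContOnCl (by rwa [hcl])) (fun w hw => ?_) (by simpa [hcl] using hz)
  rw [frontier_ball _ one_ne_zero, mem_sphere_zero_iff_norm] at hw
  exact h w hw

lemma differentiableOn_blaschkeVec {a : ℕ → ℂ} (ha : ∀ k, ‖a k‖ < 1) (n : ℕ) :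
    DifferentiableOn ℂ (blaschkeVec a n) (closedBall 0 1) := fun z hz =>
  (differentiableAt_blaschkeVec ha n (by simpa using hz)).differentiableWithinAt

/-- The supremum over the disk of `(1 - |B|²) / (1 - |z|²)` equals that of `|B'|`. -/
theorem norm_blaschkeVec_sq_le_iff {a : ℕ → ℂ} (ha : ∀ k, ‖a k‖ < 1) (n : ℕ) {c : ℝ}
    (hc : 0 ≤ c) :
    (∀ z, ‖z‖ < 1 → ‖blaschkeVec a n z‖ ^ 2 ≤ c) ↔
      ∀ z, ‖z‖ < 1 → ‖deriv (blaschkeProd a n) z‖ ≤ c := by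
  constructor
  · intro h z hz
    refine norm_le_of_norm_le_on_sphere (differentiableOn_deriv_blaschkeProd ha n)
      (fun w hw => ?_) hz.le
    rw [norm_deriv_blaschkeProd ha n hw]
    exact le_of_continuousOn_closedBall
      ((differentiableOn_blaschkeVec ha n).continuousOn.norm.pow 2) h hw.le
  · intro h z hz
    -- The maximum principle bounds the norm of G, so the square is moved to the constant.
    rw [← Real.le_sqrt (norm_nonneg _) hc]
    refine norm_le_of_norm_le_on_sphere (differentiableOn_blaschkeVec ha n) (fun w hw => ?_) hz.le
    rw [Real.le_sqrt (norm_nonneg _) hc, ← norm_deriv_blaschkeProd ha n hw]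
    exact le_of_continuousOn_closedBall
      (differentiableOn_deriv_blaschkeProd ha n).continuousOn.norm h hw.le

lemma norm_blaschkeVec_sq_lt {a : ℕ → ℂ} (ha : ∀ k, ‖a k‖ < 1) (n : ℕ) {c : ℝ} (hc : 1 < c)
    (h : ∀ z, ‖z‖ < 1 → ‖blaschkeVec a n z‖ ^ 2 ≤ c) {z : ℂ} (hz : ‖z‖ < 1) :
    ‖blaschkeVec a n z‖ ^ 2 < c := by
  refine (h z hz).lt_of_ne fun heq => ?_
  have hmax : IsMaxOn (norm ∘ blaschkeVec a n) (ball 0 1) z := fun w hw => by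
    have := h w (by simpa using hw)
    rw [← heq] at this
    exact (pow_le_pow_iff_left₀ (norm_nonneg _) (norm_nonneg _) two_ne_zero).mp this
  have hconst := Complex.norm_eqOn_of_isPreconnected_of_isMaxOn
    (convex_ball (0 : ℂ) 1).isPreconnected isOpen_ball
    ((differentiableOn_blaschkeVec ha n).mono ball_subset_closedBall) (by simpa using hz) hmax
    (mem_ball_self one_pos)
  simp only [Function.comp_apply, Function.const_apply] at hconst
  -- Constancy of ‖G‖ gives c = 1 - |B(0)|² ≤ 1 at the origin.
  have h0 := one_sub_norm_blaschkeProd_sq ha n (z := 0) (by simp)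
  rw [hconst, heq, norm_zero] at h0
  nlinarith [sq_nonneg ‖blaschkeProd a n 0‖]

/-! ### Reformulation of the conditions and conclusion. -/

lemma isFiniteBlaschkeProduct_iff {f : ℂ → ℂ} :
    IsFiniteBlaschkeProduct f ↔ ∃ (θ : ℝ) (n : ℕ) (a : ℕ → ℂ), 1 ≤ n ∧ (∀ k, ‖a k‖ < 1) ∧
      ∀ z, ‖z‖ < 1 → f z = Complex.exp (θ * Complex.I) * blaschkeProd a n z := by
  constructor
  · rintro ⟨θ, n, a, hn, ha, hf⟩
    refine ⟨θ, n, fun k => if h : k < n then a ⟨k, h⟩ else 0, hn, fun k => ?_, fun z hz => ?_⟩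
    · beta_reduce
      split_ifs with h
      · simpa using ha ⟨k, h⟩
      · simp
    · rw [hf z (by simpa using hz), blaschkeProd, Finset.prod_range]
      simp [blaschkeFactor]
  · rintro ⟨θ, n, a, hn, ha, hf⟩
    refine ⟨θ, n, fun k => a k, hn, fun k => by simpa using ha k, fun z hz => ?_⟩
    rw [hf z (by simpa using hz), blaschkeProd, Finset.prod_range]
    rfl

lemma iSup_norm_deriv_le_iff {f : ℂ → ℂ} {c : ℝ} :
    (⨆ z ∈ ball (0 : ℂ) 1, ((‖deriv f z‖ : ℝ) : EReal)) ≤ (c : EReal) ↔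
      ∀ z, ‖z‖ < 1 → ‖deriv f z‖ ≤ c := by
  simp [EReal.coe_le_coe_iff]

lemma norm_deriv_eq_of_eq_exp_mul {f B : ℂ → ℂ} {θ : ℝ}
    (hf : ∀ z, ‖z‖ < 1 → f z = Complex.exp (θ * Complex.I) * B z) {z : ℂ} (hz : ‖z‖ < 1) :
    ‖deriv f z‖ = ‖deriv B z‖ := by
  have h : f =ᶠ[𝓝 z] fun w => Complex.exp (θ * Complex.I) * B w := by
    filter_upwards [isOpen_ball.mem_nhds (show z ∈ ball (0 : ℂ) 1 by simpa using hz)] with w hw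
    exact hf w (by simpa using hw)
  rw [h.deriv_eq, deriv_const_mul_field, norm_mul, Complex.norm_exp_ofReal_mul_I, one_mul]

lemma div_eq_norm_blaschkeVec_sq {f : ℂ → ℂ} {a : ℕ → ℂ} (ha : ∀ k, ‖a k‖ < 1) {n : ℕ} {θ : ℝ}
    (hf : ∀ z, ‖z‖ < 1 → f z = Complex.exp (θ * Complex.I) * blaschkeProd a n z) {z : ℂ}
    (hz : ‖z‖ < 1) : (1 - ‖f z‖ ^ 2) / (1 - ‖z‖ ^ 2) = ‖blaschkeVec a n z‖ ^ 2 := by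
  have h : 1 - ‖z‖ ^ 2 ≠ 0 := by nlinarith [norm_nonneg z]
  rw [hf z hz, norm_mul, Complex.norm_exp_ofReal_mul_I, one_mul,
    one_sub_norm_blaschkeProd_sq ha n hz.le, mul_div_cancel_left₀ _ h]

lemma levelSetOmega_eq_ball_iff {lam : ℝ} {f : ℂ → ℂ} :
    levelSetOmega lam f = ball (0 : ℂ) 1 ↔
      ∀ z, ‖z‖ < 1 → (1 - ‖f z‖ ^ 2) / (1 - ‖z‖ ^ 2) < lam := by
  simp [levelSetOmega, Set.ext_iff]

theorem proposition3p3 (lam : ℝ) (hlam : 0 < lam) (f : ℂ → ℂ)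
    (hf : DifferentiableOn ℂ f (ball (0 : ℂ) 1))
    (hmaps : Set.MapsTo f (ball (0 : ℂ) 1) (ball (0 : ℂ) 1)) :
    levelSetOmega lam f = ball (0 : ℂ) 1 ↔
      IsFiniteBlaschkeProduct f ∧
        (⨆ z ∈ ball (0 : ℂ) 1, ((‖deriv f z‖ : ℝ) : EReal)) ≤ (lam : EReal) ∧ 1 < lam := by
  rw [levelSetOmega_eq_ball_iff, isFiniteBlaschkeProduct_iff, iSup_norm_deriv_le_iff]
  have hlt : ∀ z, ‖z‖ < 1 → ‖f z‖ < 1 := fun z hz => by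
    simpa using hmaps (show z ∈ ball 0 1 by simpa using hz)
  constructor
  · intro h
    have ht : Tendsto (fun z => ‖f z‖) nearCircle (𝓝 1) :=
      tendsto_norm_of_one_sub_sq_le lam fun z hz =>
        ⟨hlt z hz, ((div_lt_iff₀ (by nlinarith [norm_nonneg z])).mp (h z hz)).le⟩
    obtain ⟨θ, n, a, ha, hfa⟩ := exists_eq_blaschkeProd hf ht
    have hn : 1 ≤ n := by
      by_contra! hn
      have h0 := hlt 0 (by simp)
      obtain rfl : n = 0 := by omega
      rw [hfa 0 (by simp), norm_mul, Complex.norm_exp_ofReal_mul_I] at h0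
      simp [blaschkeProd] at h0
    refine ⟨⟨θ, n, a, hn, ha, hfa⟩, fun z hz => ?_, ?_⟩
    · rw [norm_deriv_eq_of_eq_exp_mul hfa hz]
      exact (norm_blaschkeVec_sq_le_iff ha n hlam.le).mp
        (fun w hw => div_eq_norm_blaschkeVec_sq ha hfa hw ▸ (h w hw).le) z hz
    -- At a zero the quotient is 1 / (1 - |a 0|²) ≥ 1.
    · have hzero : f (a 0) = 0 := by
        rw [hfa _ (ha 0), blaschkeProd,
          Finset.prod_eq_zero (Finset.mem_range.mpr hn) (by simp [blaschkeFactor]), mul_zero]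
      have h0 := h _ (ha 0)
      have hpos : 0 < 1 - ‖a 0‖ ^ 2 := by nlinarith [norm_nonneg (a 0), ha 0]
      rw [hzero, div_lt_iff₀ hpos, norm_zero] at h0
      nlinarith [sq_nonneg ‖a 0‖]
  · rintro ⟨⟨θ, n, a, -, ha, hfa⟩, hderiv, hone⟩ z hz
    rw [div_eq_norm_blaschkeVec_sq ha hfa hz]
    refine norm_blaschkeVec_sq_lt ha n hone ?_ hz
    exact (norm_blaschkeVec_sq_le_iff ha n hlam.le).mpr fun w hw =>
      norm_deriv_eq_of_eq_exp_mul hfa hw ▸ hderiv w hw
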